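/- A finite simplicial complex $X$ is a finite downward closed family of finite sets. If $\eta\in X$ satisfies $|\eta|\le d$ and is contained in a unique maximal face $\tau$ of $X$, then $X\setminus\{\sigma\in X:\eta\subseteq\sigma\subseteq\tau\}$ is said to be obtained from $X$ by an elementary $d$-collapse; $X$ is $d$-collapsible if a finite sequence of elementary $d$-collapses leads from $X$ to the void complex (the complex with no faces, not even the empty one). For a finite hypergraph $\mathcal H$ (identified with its set of edges) let $$\mathrm{Int}_{\mathcal H}=\{\mathcal F\subseteq\mathcal H:\ A\cap B\neq\emptyset\text{ for all }A,B\in\mathcal F\}.$$ A hypergraph $\mathcal H$ on vertex set $V$ is $r$-partite $r$-uniform if $V$ is a disjoint union $V=V_1\,\dot\cup\cdots\dot\cup\,V_r$ such that $|A\cap V_i|=1$ for all $A\in\mathcal H$ and $1\le i\le r$. Theorem. Let $r\ge 1$. If $\mathcal H$ is a finite $r$-partite $r$-uniform hypergraph, then $\mathrm{Int}_{\mathcal H}$ is $2^{r-1}$-collapsible. The bound is tight for every $r\ge1$: if $\mathcal H$ is the complete $r$-partite $r$-uniform hypergraph with all sides of size $2$ (its edges are all sets meeting each side in exactly one vertex),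 then $2^{r-1}$ is the least $d$ for which $\mathrm{Int}_{\mathcal H}$ is $d$-collapsible. -/

import Mathlib

/-- A finite abstract simplicial complex: a finite, downward closed family of finite sets.
The empty set is a face of every complex except the void complex, which has no faces at all. -/
structure FinComplex (α : Type*) where
  faces : Finset (Finset α)
  down_closed : ∀ σ ∈ faces, ∀ ρ ⊆ σ, ρ ∈ faces

namespace FinComplex

variable {α : Type*} [DecidableEq α]

/-- The void complex, with no faces (not even the empty one). -/
def void (α : Type*) : FinComplex α where
  faces := ∅
  down_closed := fun σ hσ => absurd hσ (Finset.notMem_empty σ)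

/-- `τ` is the unique maximal face of `X` that contains `η`. -/
def IsUniqueMaximalFaceAbove (X : FinComplex α) (η τ : Finset α) : Prop :=
  (Maximal (· ∈ X.faces) τ ∧ η ⊆ τ) ∧
    ∀ τ', Maximal (· ∈ X.faces) τ' → η ⊆ τ' → τ' = τ

/-- `X'` is obtained from `X` by an elementary `d`-collapse: for some face `η` of `X` with at
most `d` vertices, contained in a unique maximal face `τ`, all faces `σ` with
`η ⊆ σ ⊆ τ` are removed. -/
def ElementaryCollapse (d : ℕ) (X X' : FinComplex α) : Prop :=
  ∃ η ∈ X.faces, η.card ≤ d ∧ ∃ τ, X.IsUniqueMaximalFaceAbove η τ ∧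
    X'.faces = X.faces.filter (fun σ => ¬ (η ⊆ σ ∧ σ ⊆ τ))

/-- `X` is `d`-collapsible: some finite sequence of elementary `d`-collapses leads from `X` to
the void complex. -/
def IsCollapsible (d : ℕ) (X : FinComplex α) : Prop :=
  Relation.ReflTransGen (ElementaryCollapse d) X (void α)

end FinComplex

/-- The complex whose simplices are the pairwise intersecting subfamilies of the finite
hypergraph `H`. -/
def intComplex {V : Type*} [DecidableEq V] (H : Finset (Finset V)) : FinComplex (Finset V) where
  faces := H.powerset.filter (fun F => ∀ A ∈ F, ∀ B ∈ F, A ∩ B ≠ ∅)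
  down_closed := by
    intro σ hσ ρ hρ
    rw [Finset.mem_filter, Finset.mem_powerset] at hσ ⊢
    exact ⟨hρ.trans hσ.1, fun A hA B hB => hσ.2 A (hρ hA) B (hρ hB)⟩

/-- `A` meets each of the sets `P i` in exactly one vertex. -/
def IsTransversal {V : Type*} {r : ℕ} (P : Fin r → Set V) (A : Finset V) : Prop :=
  ∀ i, ((A : Set V) ∩ P i).ncard = 1

/-- `H` is an `r`-partite `r`-uniform hypergraph: the vertex set is a disjoint union of `r` sides
such that each edge meets each side in exactly one vertex. -/
def IsPartiteUniform {V : Type*} (r : ℕ) (H : Finset (Finset V)) : Prop :=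
  ∃ P : Fin r → Set V, Pairwise (fun i j => Disjoint (P i) (P j)) ∧ (⋃ i, P i) = Set.univ ∧
    ∀ A ∈ H, IsTransversal P A

open Classical in
/-- The complete `r`-partite `r`-uniform hypergraph all of whose sides have size `2`: the vertex
set is `Fin r × Fin 2`, the `i`-th side is `{i} × Fin 2`, and the edges are all vertex sets that
meet each side in exactly one vertex. -/
noncomputable def completePartiteTwo (r : ℕ) : Finset (Finset (Fin r × Fin 2)) :=
  Finset.univ.filter (IsTransversal (fun i => {v | v.1 = i}))

open Finset

/-! ### A sufficient criterion for collapsibility. -/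

namespace FinComplex

variable {α : Type*}

/-! Upper bound: a complex is `d`-collapsible once its faces that are exclusion sets have size at
most `d` (`reflTransGen_delete`). In the intersection complex such a face yields edges `A₁, …, Aₘ`,
pairwise intersecting, and edges `Bᵢ` with `Aᵢ ∩ Bᵢ = ∅` and `Bᵢ` meeting every earlier `Aⱼ`. The
pairs `(Aᵢ, Bᵢ)` followed by the reversed list of `(Bᵢ, Aᵢ)` form a skew system, so `2m ≤ 2 ^ r` by
`card_le_two_pow_of_skew`.

Tightness: the families choosing one edge from each complementary pair are faces with at least `2 ^
(r - 1)` edges, and exchanging an edge for its complement shows that no collapse with smaller `η`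
can remove any of them. -/

@[ext] theorem ext {X Y : FinComplex α} (h : ∀ σ, σ ∈ X.faces ↔ σ ∈ Y.faces) : X = Y := by
  cases X; cases Y
  congr
  exact Finset.ext h

theorem exists_maximal_above (X : FinComplex α) {S : Finset α} (hS : S ∈ X.faces) :
    ∃ τ, Maximal (· ∈ X.faces) τ ∧ S ⊆ τ := by
  obtain ⟨τ, h, hτ⟩ := X.faces.exists_le_maximal hS
  exact ⟨τ, hτ, h⟩

variable [DecidableEq α]

/-- The faces of `Y` that do not both contain `S` and meet `W`. -/
def restrict (Y : FinComplex α) (S W : Finset α) : FinComplex α where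
  faces := Y.faces.filter (fun σ => ¬ (S ⊆ σ ∧ ¬ Disjoint σ W))
  down_closed := by
    intro σ hσ ρ hρ
    rw [mem_filter] at hσ ⊢
    exact ⟨Y.down_closed σ hσ.1 ρ hρ,
      fun h => hσ.2 ⟨h.1.trans hρ, fun hd => h.2 (hd.mono_left hρ)⟩⟩

/-- The faces of `Y` that do not contain `S`. -/
def delete (Y : FinComplex α) (S : Finset α) : FinComplex α where
  faces := Y.faces.filter (fun σ => ¬ S ⊆ σ)
  down_closed := by
    intro σ hσ ρ hρ
    rw [mem_filter] at hσ ⊢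
    exact ⟨Y.down_closed σ hσ.1 ρ hρ, fun h => hσ.2 (h.trans hρ)⟩

theorem mem_restrict {Y : FinComplex α} {S W σ : Finset α} :
    σ ∈ (Y.restrict S W).faces ↔ σ ∈ Y.faces ∧ (S ⊆ σ → Disjoint σ W) := by
  simp [restrict]

theorem mem_delete {Y : FinComplex α} {S σ : Finset α} :
    σ ∈ (Y.delete S).faces ↔ σ ∈ Y.faces ∧ ¬ S ⊆ σ := by
  simp [delete]

/-- Sets obtained from `∅` by repeatedly adding an element outside some maximal face of `X`
that contains the elements added before. -/
inductive IsExclusionSet (X : FinComplex α) : Finset α → Prop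
  | empty : IsExclusionSet X ∅
  | insert {S τ : Finset α} {v : α} (hS : IsExclusionSet X S)
      (hτ : Maximal (· ∈ X.faces) τ) (hSτ : S ⊆ τ) (hv : v ∉ τ) : IsExclusionSet X (insert v S)

/-- Faces above `S` that leave a chosen maximal face `τ` are removed first, one outside vertex `v`
at a time, by recursion on `insert v S`. Then `S` lies in a unique maximal face and can be
collapsed. The set `N` records vertices already cleared above `S`. -/
theorem reflTransGen_delete {X : FinComplex α} {d : ℕ}
    (hd : ∀ S ∈ X.faces, X.IsExclusionSet S → S.card ≤ d) (S : Finset α)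
    (hS : X.IsExclusionSet S) (Y : FinComplex α) (N : Finset α)
    (hY : ∀ σ, S ⊆ σ → (σ ∈ Y.faces ↔ σ ∈ X.faces ∧ Disjoint σ N)) :
    Relation.ReflTransGen (ElementaryCollapse d) Y (Y.delete S) := by
  induction hn : (X.faces.filter (S ⊆ ·)).card using Nat.strong_induction_on
    generalizing S Y N with
  | _ n ih =>
  by_cases hSY : S ∈ Y.faces
  swap
  · have : Y.delete S = Y := by
      ext σ
      rw [mem_delete, and_iff_left_iff_imp]
      exact fun h h' => hSY (Y.down_closed σ h S h')
    rw [this]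
  obtain ⟨hSX, hSN⟩ := (hY S subset_rfl).1 hSY
  obtain ⟨τ, hτ, hSτ⟩ := X.exists_maximal_above hSX
  have key : ∀ W : Finset α, Disjoint W τ →
      Relation.ReflTransGen (ElementaryCollapse d) Y (Y.restrict S W) := by
    intro W
    induction W using Finset.induction_on with
    | empty =>
      intro _
      have : Y.restrict S ∅ = Y := by ext σ; simp [mem_restrict]
      rw [this]
    | insert v W hvW ihW =>
      intro hW
      rw [disjoint_insert_left] at hW
      have hlt : (X.faces.filter (insert v S ⊆ ·)).card < n := by
        rw [← hn]
        refine card_lt_card ⟨monotone_filter_right _ fun σ _ h => (subset_insert v S).trans h,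
          fun h => ?_⟩
        have := (mem_filter.1 (h (mem_filter.2 ⟨hSX, subset_rfl⟩))).2
        exact hW.1 (hSτ (this (mem_insert_self v S)))
      have step := ih _ hlt (insert v S) (hS.insert hτ hSτ hW.1) (Y.restrict S W) (N ∪ W)
        (fun σ hσ => by
          have h' := (subset_insert v S).trans hσ
          rw [mem_restrict, hY σ h', disjoint_union_right]
          tauto) rfl
      have : (Y.restrict S W).delete (insert v S) = Y.restrict S (insert v W) := by
        ext σ
        rw [mem_delete, mem_restrict, mem_restrict, disjoint_insert_right, insert_subset_iff]
        tauto
      rw [this] at step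
      exact (ihW hW.2).trans step
  -- Clearing all vertices outside `τ` leaves, above `S`, exactly the subsets of `τ \ N`.
  refine (key (X.faces.sup id \ τ) sdiff_disjoint).tail ?_
  have hmem : ∀ σ, S ⊆ σ → (σ ∈ (Y.restrict S (X.faces.sup id \ τ)).faces ↔ σ ⊆ τ \ N) := by
    intro σ hσ
    rw [mem_restrict, hY σ hσ, subset_sdiff]
    constructor
    · rintro ⟨⟨h1, h2⟩, h3⟩
      refine ⟨fun x hx => ?_, h2⟩
      by_contra hxτ
      exact disjoint_left.1 (h3 hσ) hx
        (mem_sdiff.2 ⟨(le_sup (f := id) h1 : σ ≤ X.faces.sup id) hx, hxτ⟩)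
    · rintro ⟨h1, h2⟩
      exact ⟨⟨X.down_closed τ hτ.prop σ h1, h2⟩, fun _ => disjoint_sdiff.mono_left h1⟩
  have hSt : S ⊆ τ \ N := subset_sdiff.2 ⟨hSτ, hSN⟩
  have htm := (hmem _ hSt).2 subset_rfl
  refine ⟨S, (hmem S subset_rfl).2 hSt, hd S hSX hS, τ \ N, ⟨⟨⟨htm, ?_⟩, hSt⟩, ?_⟩, ?_⟩
  · exact fun ρ hρ hle => (hmem ρ (hSt.trans hle)).1 hρ
  · intro τ' hτ' hSτ'
    have h := (hmem τ' hSτ').1 hτ'.prop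
    exact h.antisymm (hτ'.le_of_ge htm h)
  · ext σ
    rw [mem_delete, mem_filter]
    by_cases hσ : S ⊆ σ
    · have := hmem σ hσ
      tauto
    · rw [mem_restrict]
      tauto

/-- If all faces that are exclusion sets have at most `d` elements, then the complex is
`d`-collapsible. -/
theorem isCollapsible_of_exclusionSet {X : FinComplex α} {d : ℕ}
    (hd : ∀ S ∈ X.faces, X.IsExclusionSet S → S.card ≤ d) : X.IsCollapsible d := by
  have h := reflTransGen_delete hd ∅ .empty X ∅ (by simp)
  have : X.delete ∅ = void α := by
    ext σ
    simp [mem_delete, void]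
  rwa [this] at h

end FinComplex

/-! ### The skew set-pair inequality. -/

/-- Skew set-pair inequality for tuples: if `a i` and `b i` differ everywhere, while `a i` and
`b j` agree somewhere for `i < j`, then there are at most `2 ^ r` pairs. -/
theorem card_le_two_pow_of_skew {ι V : Type*} [Fintype ι] [LinearOrder ι] {r : ℕ}
    (a b : ι → Fin r → V) (hdiag : ∀ i l, a i l ≠ b i l)
    (hskew : ∀ i j, i < j → ∃ l, a i l = b j l) : Fintype.card ι ≤ 2 ^ r := by
  -- Vertices become independent indeterminates. Expanding `∏ l, (e (a i l) - e (b j l))` over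
  -- subsets of `Fin r` factors a triangular matrix through dimension `2 ^ r`.
  let K := FractionRing (MvPolynomial V ℚ)
  let e : V → K := fun v => algebraMap (MvPolynomial V ℚ) K (MvPolynomial.X v)
  have he : Function.Injective e :=
    (IsFractionRing.injective (MvPolynomial V ℚ) K).comp (MvPolynomial.X_injective)
  let P : Matrix ι (Finset (Fin r)) K := fun i s => ∏ l ∈ s, e (a i l)
  let Q : Matrix (Finset (Fin r)) ι K := fun s j => ∏ l ∈ univ \ s, (-e (b j l))
  have hPQ : ∀ i j, (P * Q) i j = ∏ l, (e (a i l) - e (b j l)) := by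
    intro i j
    rw [Matrix.mul_apply]
    simp only [sub_eq_add_neg, Finset.prod_add, P, Q, powerset_univ]
  have hdet : (P * Q).det ≠ 0 := by
    rw [Matrix.det_of_isLowerTriangular]
    · refine prod_ne_zero_iff.2 fun i _ => ?_
      rw [hPQ]
      exact prod_ne_zero_iff.2 fun l _ => sub_ne_zero.2 fun h => hdiag i l (he h)
    · intro i j hij
      obtain ⟨l, hl⟩ := hskew i j hij
      rw [hPQ]
      exact prod_eq_zero (mem_univ l) (by rw [hl, sub_self])
  have hrank : (P * Q).rank = Fintype.card ι :=
    Matrix.rank_of_isUnit _ ((Matrix.isUnit_iff_isUnit_det _).2 hdet.isUnit)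
  calc Fintype.card ι = (P * Q).rank := hrank.symm
    _ ≤ P.rank := Matrix.rank_mul_le_left P Q
    _ ≤ Fintype.card (Finset (Fin r)) := Matrix.rank_le_card_width P
    _ = 2 ^ r := by simp

/-- Skew set-pair inequality for transversals of an `r`-partition. -/
theorem length_le_two_pow_of_skew {V : Type*} [DecidableEq V] {r : ℕ} {P : Fin r → Set V}
    (hP : (⋃ i, P i) = Set.univ) (L : List (Finset V × Finset V))
    (htr : ∀ p ∈ L, IsTransversal P p.1 ∧ IsTransversal P p.2 ∧ p.1 ∩ p.2 = ∅)
    (hL : L.Pairwise (fun p q => p.1 ∩ q.2 ≠ ∅)) : L.length ≤ 2 ^ r := by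
  have hex : ∀ A : Finset V, IsTransversal P A → ∃ f : Fin r → V, ∀ i, (A : Set V) ∩ P i = {f i} :=
    fun A hA => by
      choose f hf using fun i => Set.ncard_eq_one.1 (hA i)
      exact ⟨f, hf⟩
  have mem_iff : ∀ {A : Finset V} {f : Fin r → V}, (∀ i, (A : Set V) ∩ P i = {f i}) →
      ∀ i x, (x ∈ A ∧ x ∈ P i) ↔ x = f i := by
    intro A f h i x
    have := Set.ext_iff.1 (h i) x
    simpa using this
  choose a ha using fun i : Fin L.length => hex _ (htr L[i] (L.getElem_mem i.2)).1
  choose b hb using fun i : Fin L.length => hex _ (htr L[i] (L.getElem_mem i.2)).2.1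
  have := card_le_two_pow_of_skew a b (fun i l h => ?_) (fun i j hij => ?_)
  · simpa using this
  · have h1 := ((mem_iff (ha i) l (a i l)).2 rfl).1
    have h2 := ((mem_iff (hb i) l (a i l)).2 h).1
    have h3 := (htr L[i] (L.getElem_mem i.2)).2.2
    exact notMem_empty _ (h3 ▸ mem_inter.2 ⟨h1, h2⟩)
  · have h := List.pairwise_iff_getElem.1 hL i j i.2 j.2 hij
    obtain ⟨x, hx⟩ := nonempty_iff_ne_empty.2 h
    rw [mem_inter] at hx
    obtain ⟨l, hl⟩ := Set.mem_iUnion.1 (hP ▸ Set.mem_univ x : x ∈ ⋃ i, P i)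
    exact ⟨l, ((mem_iff (ha i) l x).1 ⟨hx.1, hl⟩).symm.trans ((mem_iff (hb j) l x).1 ⟨hx.2, hl⟩)⟩

/-! ### The upper bound for intersecting families. -/

theorem mem_intComplex {V : Type*} [DecidableEq V] {H : Finset (Finset V)}
    {F : Finset (Finset V)} :
    F ∈ (intComplex H).faces ↔ F ⊆ H ∧ ∀ A ∈ F, ∀ B ∈ F, A ∩ B ≠ ∅ := by
  simp [intComplex]

/-- The elements of an exclusion set of `intComplex H` can be listed, latest first, together with
disjoint edges, such that each edge witnessing the exclusion meets all elements added before. -/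
theorem exists_list_of_isExclusionSet {V : Type*} [DecidableEq V] {H : Finset (Finset V)}
    {S : Finset (Finset V)} (hS : (intComplex H).IsExclusionSet S)
    (hSX : S ∈ (intComplex H).faces) :
    ∃ L : List (Finset V × Finset V), S.card ≤ L.length ∧ (∀ p ∈ L, p.1 ∈ S) ∧
      (∀ p ∈ L, p.2 ∈ H ∧ p.1 ∩ p.2 = ∅) ∧ L.Pairwise (fun p q => q.1 ∩ p.2 ≠ ∅) := by
  induction hS with
  | empty => exact ⟨[], by simp⟩
  | @insert S τ A hS hτ hSτ hA ih =>
    obtain ⟨L, h1, h2, h3, h4⟩ := ih ((intComplex H).down_closed _ hSX _ (subset_insert A S))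
    have hτm := mem_intComplex.1 hτ.prop
    rw [mem_intComplex] at hSX
    have hAS := mem_insert_self A S
    -- If `A` met every member of `τ`, then `insert A τ` would be a face, against maximality.
    obtain ⟨B, hB, hAB⟩ : ∃ B ∈ τ, A ∩ B = ∅ := by
      by_contra! hcon
      refine hA (hτ.le_of_ge (y := insert A τ) (mem_intComplex.2 ⟨?_, ?_⟩) (subset_insert A τ)
        (mem_insert_self A τ))
      · exact insert_subset (hSX.1 hAS) hτm.1
      · intro C hC D hD
        rcases mem_insert.1 hC with rfl | hC' <;> rcases mem_insert.1 hD with rfl | hD'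
        · exact hSX.2 _ hAS _ hAS
        · exact (hcon D hD').ne_empty
        · rw [inter_comm]
          exact (hcon C hC').ne_empty
        · exact hτm.2 C hC' D hD'
    refine ⟨(A, B) :: L, ?_, ?_, ?_, ?_⟩
    · exact (card_insert_le A S).trans (by simpa using h1)
    · exact List.forall_mem_cons.2 ⟨hAS, fun p hp => mem_insert_of_mem (h2 p hp)⟩
    · exact List.forall_mem_cons.2 ⟨⟨hτm.1 hB, hAB⟩, h3⟩
    · exact List.pairwise_cons.2 ⟨fun q hq => hτm.2 _ (hSτ (h2 q hq)) _ hB, h4⟩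

theorem IsPartiteUniform.isCollapsible {V : Type*} [DecidableEq V] {r : ℕ} (hr : 1 ≤ r)
    {H : Finset (Finset V)} (hH : IsPartiteUniform r H) :
    (intComplex H).IsCollapsible (2 ^ (r - 1)) := by
  obtain ⟨P, -, hP, hT⟩ := hH
  refine FinComplex.isCollapsible_of_exclusionSet fun S hSX hS => ?_
  obtain ⟨L, h1, h2, h3, h4⟩ := exists_list_of_isExclusionSet hS hSX
  rw [mem_intComplex] at hSX
  have hlen := length_le_two_pow_of_skew hP (L.reverse ++ L.map Prod.swap) ?_ ?_
  · rw [List.length_append, List.length_reverse, List.length_map] at hlen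
    obtain ⟨k, rfl⟩ := Nat.exists_eq_add_of_le' hr
    rw [pow_succ] at hlen
    rw [Nat.add_sub_cancel]
    omega
  · intro p hp
    rw [List.mem_append, List.mem_reverse, List.mem_map] at hp
    rcases hp with hp | ⟨q, hq, rfl⟩
    · exact ⟨hT _ (hSX.1 (h2 p hp)), hT _ (h3 p hp).1, (h3 p hp).2⟩
    · exact ⟨hT _ (h3 q hq).1, hT _ (hSX.1 (h2 q hq)), by
        rw [Prod.fst_swap, Prod.snd_swap, inter_comm]; exact (h3 q hq).2⟩
  · rw [List.pairwise_append, List.pairwise_reverse, List.pairwise_map]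
    refine ⟨h4, h4.imp fun {p q} h => by rwa [Prod.fst_swap, Prod.snd_swap, inter_comm], ?_⟩
    intro p hp q hq
    obtain ⟨q, hq', rfl⟩ := List.mem_map.1 hq
    -- Across the two halves, the condition says that members of `S` intersect.
    exact hSX.2 _ (h2 p (List.mem_reverse.1 hp)) _ (h2 q hq')

/-! ### Tightness for sides of size two. -/

theorem mem_completePartiteTwo {r : ℕ} {A : Finset (Fin r × Fin 2)} :
    A ∈ completePartiteTwo r ↔ ∀ i, ((i, 0) ∈ A ↔ (i, 1) ∉ A) := by
  classical
  simp only [completePartiteTwo, IsTransversal, mem_filter, mem_univ, true_and]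
  refine forall_congr' fun i => ?_
  have h : (A : Set (Fin r × Fin 2)) ∩ {v | v.1 = i} =
      ((({(i, 0), (i, 1)} : Finset (Fin r × Fin 2)).filter (· ∈ A) : Finset _) :
        Set (Fin r × Fin 2)) := by
    ext ⟨j, x⟩
    fin_cases x <;> simp [and_comm]
  rw [h, Set.ncard_coe_finset, filter_insert, filter_singleton]
  by_cases h0 : (i, 0) ∈ A <;> by_cases h1 : (i, 1) ∈ A <;> simp [h0, h1]

theorem compl_mem_completePartiteTwo {r : ℕ} {A : Finset (Fin r × Fin 2)}
    (hA : A ∈ completePartiteTwo r) : Aᶜ ∈ completePartiteTwo r := by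
  rw [mem_completePartiteTwo] at hA ⊢
  intro i
  have := hA i
  simp only [mem_compl]
  tauto

theorem eq_compl_of_inter_eq_empty {r : ℕ} {A B : Finset (Fin r × Fin 2)}
    (hA : A ∈ completePartiteTwo r) (hB : B ∈ completePartiteTwo r) (h : A ∩ B = ∅) :
    B = Aᶜ := by
  rw [mem_completePartiteTwo] at hA hB
  have hd : ∀ v ∈ A, v ∉ B := fun v hv hv' => notMem_empty v (h ▸ mem_inter.2 ⟨hv, hv'⟩)
  ext ⟨i, x⟩
  have h1 := hA i
  have h2 := hB i
  have h3 := hd (i, 0)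
  have h4 := hd (i, 1)
  rw [mem_compl]
  fin_cases x <;> simp only [Fin.zero_eta, Fin.mk_one] <;> tauto

theorem two_pow_le_card_completePartiteTwo (r : ℕ) : 2 ^ r ≤ (completePartiteTwo r).card := by
  have hcard : (univ : Finset (Fin r → Fin 2)).card = 2 ^ r := by simp
  rw [← hcard]
  refine card_le_card_of_injOn (fun f => univ.filter fun v => f v.1 = v.2) ?_ ?_
  · intro f _
    rw [mem_coe, mem_completePartiteTwo]
    intro i
    simp only [mem_filter, mem_univ, true_and]
    omega
  · intro f _ g _ h
    funext i
    have := Finset.ext_iff.1 h (i, g i)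
    simpa using this

theorem isPartiteUniform_completePartiteTwo (r : ℕ) :
    IsPartiteUniform r (completePartiteTwo r) := by
  refine ⟨fun i => {v | v.1 = i}, fun i j hij => ?_, ?_, ?_⟩
  · exact Set.disjoint_left.2 fun v hv hv' => hij (hv.symm.trans hv')
  · ext v
    simp
  · intro A hA
    simpa [completePartiteTwo] using hA

/-- Families that contain exactly one edge out of each pair of complementary edges. -/
def IsComplSelection {r : ℕ} (F : Finset (Finset (Fin r × Fin 2))) : Prop :=
  F ⊆ completePartiteTwo r ∧ ∀ A ∈ completePartiteTwo r, (A ∈ F ↔ Aᶜ ∉ F)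

namespace IsComplSelection

variable {r : ℕ} {F : Finset (Finset (Fin r × Fin 2))}

theorem mem_faces (hF : IsComplSelection F) : F ∈ (intComplex (completePartiteTwo r)).faces := by
  refine mem_intComplex.2 ⟨hF.1, fun A hA B hB h => ?_⟩
  have := eq_compl_of_inter_eq_empty (hF.1 hA) (hF.1 hB) h
  exact (hF.2 A (hF.1 hA)).1 hA (this ▸ hB)

theorem two_pow_le_card (hF : IsComplSelection F) (hr : 1 ≤ r) : 2 ^ (r - 1) ≤ F.card := by
  have hsub : completePartiteTwo r ⊆ F ∪ F.image compl := by
    intro A hA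
    rw [mem_union, mem_image]
    by_cases h : A ∈ F
    · exact Or.inl h
    · exact Or.inr ⟨Aᶜ, by_contra fun h' => h ((hF.2 A hA).2 h'), compl_compl A⟩
  have h1 := (two_pow_le_card_completePartiteTwo r).trans
    ((card_le_card hsub).trans (card_union_le _ _))
  have h2 : (F.image compl).card ≤ F.card := card_image_le
  obtain ⟨k, rfl⟩ := Nat.exists_eq_add_of_le' hr
  rw [pow_succ] at h1
  rw [Nat.add_sub_cancel]
  omega

/-- Exchanging one edge for its complement. -/
theorem exchange (hF : IsComplSelection F) {A : Finset (Fin r × Fin 2)} (hA : A ∈ F) :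
    IsComplSelection (insert Aᶜ (F.erase A)) := by
  have hAH := hF.1 hA
  refine ⟨insert_subset (compl_mem_completePartiteTwo hAH) ((erase_subset _ _).trans hF.1), ?_⟩
  intro B hB
  have hcA := (hF.2 A hAH).1 hA
  have hBF := hF.2 B hB
  have hne : B ≠ Bᶜ := fun h => by
    rw [← h] at hBF
    tauto
  simp only [mem_insert, mem_erase, compl_inj_iff]
  by_cases h1 : B = A
  · subst h1
    simp [hne]
  · by_cases h2 : B = Aᶜ
    · subst h2
      simp [compl_compl, h1]
    · have h3 : Bᶜ ≠ A := fun h => h2 (by rw [← h, compl_compl])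
      tauto

theorem exists_of_pos (hr : 1 ≤ r) : ∃ F : Finset (Finset (Fin r × Fin 2)), IsComplSelection F :=
  ⟨(completePartiteTwo r).filter (((⟨0, hr⟩ : Fin r), (0 : Fin 2)) ∈ ·), filter_subset _ _,
    fun A hA => by simp [hA, compl_mem_completePartiteTwo hA]⟩

end IsComplSelection

theorem IsComplSelection.mem_faces_of_reflTransGen {r d : ℕ} (hr : 1 ≤ r) (hd : d < 2 ^ (r - 1))
    {Y : FinComplex (Finset (Fin r × Fin 2))}
    (hY : Relation.ReflTransGen (FinComplex.ElementaryCollapse d)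
      (intComplex (completePartiteTwo r)) Y) :
    Y.faces ⊆ (intComplex (completePartiteTwo r)).faces ∧
      ∀ F, IsComplSelection F → F ∈ Y.faces := by
  induction hY with
  | refl => exact ⟨subset_rfl, fun F hF => hF.mem_faces⟩
  | @tail Y Z _ hYZ ih =>
    obtain ⟨η, hη, hηd, τ, ⟨⟨hτ, hητ⟩, huniq⟩, hZ⟩ := hYZ
    rw [hZ]
    refine ⟨(filter_subset _ _).trans ih.1, fun F hF => mem_filter.2 ⟨ih.2 F hF, ?_⟩⟩
    rintro ⟨hηF, hFτ⟩
    obtain ⟨A, hAF, hAη⟩ : ∃ A ∈ F, A ∉ η := by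
      by_contra! h
      have := card_le_card (show F ⊆ η from h)
      have := hF.two_pow_le_card hr
      omega
    -- The exchanged selection still contains `η`, so uniqueness forces it into `τ`, which would
    -- then contain both `A` and `Aᶜ`.
    obtain ⟨τ', hτ', hFτ'⟩ := Y.exists_maximal_above (ih.2 _ (hF.exchange hAF))
    have hητ' : η ⊆ τ' := fun B hB => hFτ' (mem_insert_of_mem
      (mem_erase.2 ⟨fun h => hAη (h ▸ hB), hηF hB⟩))
    have hcA : Aᶜ ∈ τ := huniq τ' hτ' hητ' ▸ hFτ' (mem_insert_self _ _)
    exact (mem_intComplex.1 (ih.1 hτ.prop)).2 A (hFτ hAF) Aᶜ hcA (inter_compl A)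

theorem mainTheorem10 (r : ℕ) (hr : 1 ≤ r) :
    (∀ (V : Type*) [DecidableEq V] (H : Finset (Finset V)), IsPartiteUniform r H →
      (intComplex H).IsCollapsible (2 ^ (r - 1))) ∧
    (IsPartiteUniform r (completePartiteTwo r) ∧
      IsLeast {d : ℕ | (intComplex (completePartiteTwo r)).IsCollapsible d} (2 ^ (r - 1))) := by
  refine ⟨fun V _ H hH => hH.isCollapsible hr, isPartiteUniform_completePartiteTwo r,
    (isPartiteUniform_completePartiteTwo r).isCollapsible hr, fun d hd => ?_⟩
  by_contra! hlt
  obtain ⟨F, hF⟩ := IsComplSelection.exists_of_pos hr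
  exact notMem_empty F ((IsComplSelection.mem_faces_of_reflTransGen hr hlt hd).2 F hF)
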